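/- Let $X$ be a complex Banach space and let $T$ be a bounded linear operator on $X$. Write $N(\cdot)$ and $R(\cdot)$ for null space and range, $\sigma(T)$ for the spectrum, and let $\omega(T)$ (the Weyl spectrum) be the set of $\lambda\in\mathbb{C}$ for which $T-\lambda$ is not a Fredholm operator of index $0$, the index being $\dim N(T-\lambda)-\dim X/R(T-\lambda)$. Let $$\pi_{00}(T)=\{\lambda : \lambda \text{ is an isolated point of } \sigma(T) \text{ and } 0<\dim N(T-\lambda)<\infty\}.$$ Weyl's theorem is said to hold for $T$ if $\sigma(T)\setminus\omega(T)=\pi_{00}(T)$. For closed $G\subseteq\mathbb{C}$, let $\mathcal{X}_T(G)$ (the glocal spectral subspace) be the set of $x\in X$ for which there is an analytic $f:\mathbb{C}\setminus G\to X$ with $(T-\lambda)f(\lambda)=x$ for all $\lambda\in\mathbb{C}\setminus G$. The reduced minimum modulus of $T$ is the function $\gamma_T:\mathbb{C}\to[0,\infty]$, $$\gamma_T(\zeta)=\inf\left\{\frac{\|(T-\zeta)x\|}{\operatorname{dist}(x,N(T-\zeta))} : x\in X\setminus N(T-\zeta)\right\},\qquad \inf\emptyset=\infty.$$ Suppose that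 $T$ has the single valued extension property (SVEP): for every open $U\subseteq\mathbb{C}$, the only analytic $f:U\to X$ with $(T-\lambda)f(\lambda)=0$ for all $\lambda\in U$ is $f=0$. Then the following are equivalent: (i) Weyl's theorem holds for $T$; (ii) $R(T-\lambda)$ is closed for every $\lambda\in\pi_{00}(T)$; (iii) $\mathcal{X}_T(\{\lambda\})$ is finite dimensional for every $\lambda\in\pi_{00}(T)$; (iv) $\gamma_T$ is discontinuous at every point $\lambda\in\pi_{00}(T)$. -/

import Mathlib

open scoped ENNReal Topology

noncomputable section

namespace SpectralTheory

variable {X : Type*} [NormedAddCommGroup X] [NormedSpace ℂ X]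

/-- The operator `T - λ`. -/
def shift (T : X →L[ℂ] X) (l : ℂ) : X →L[ℂ] X :=
  T - l • ContinuousLinearMap.id ℂ X

/-- `T` is Weyl: Fredholm of index `dim N(T) - dim X / R(T)` equal to zero
(both dimensions are finite for a Fredholm operator). -/
structure IsWeyl (T : X →L[ℂ] X) : Prop where
  isFredholm : T.IsFredholm
  index_eq_zero : (Module.finrank ℂ T.ker : ℤ) - (Module.finrank ℂ (X ⧸ T.range) : ℤ) = 0

/-- The Weyl spectrum `ω(T)`. -/
def weylSpectrum (T : X →L[ℂ] X) : Set ℂ :=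
  {l | ¬ IsWeyl (shift T l)}

/-- `iso K = K \ acc K`: the isolated points of `K`. -/
def iso (K : Set ℂ) : Set ℂ :=
  K \ {l | AccPt l (Filter.principal K)}

/-- `π₀₀(T)`: the isolated points `λ` of the spectrum with `0 < dim N(T - λ) < ∞`. -/
def pi00 (T : X →L[ℂ] X) : Set ℂ :=
  {l | l ∈ iso (spectrum ℂ T) ∧
    0 < Module.rank ℂ (shift T l).ker ∧ Module.rank ℂ (shift T l).ker < Cardinal.aleph0}

/-- Weyl's theorem holds for `T`: `σ(T) \ ω(T) = π₀₀(T)`. -/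
def WeylTheoremHolds (T : X →L[ℂ] X) : Prop :=
  spectrum ℂ T \ weylSpectrum T = pi00 T

/-- The single valued extension property: on every open set `U`, the only analytic solution of
`(T - λ) f(λ) = 0` is the zero function. -/
def HasSVEP (T : X →L[ℂ] X) : Prop :=
  ∀ U : Set ℂ, IsOpen U → ∀ f : ℂ → X, AnalyticOnNhd ℂ f U →
    (∀ l ∈ U, shift T l (f l) = 0) → ∀ l ∈ U, f l = 0

/-- The glocal spectral subspace `𝒳_T(G)` (of interest for closed `G`): the vectors `x` for which
there is an analytic `f : ℂ \ G → X` with `(T - λ) f(λ) = x` on all of `ℂ \ G`. -/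
def glocalSubspace (T : X →L[ℂ] X) (G : Set ℂ) : Submodule ℂ X where
  carrier := {x | ∃ f : ℂ → X, AnalyticOnNhd ℂ f Gᶜ ∧ ∀ l ∈ Gᶜ, shift T l (f l) = x}
  zero_mem' := ⟨fun _ => 0, analyticOnNhd_const, fun l _ => map_zero _⟩
  add_mem' := by
    rintro x y ⟨f, hf, hfx⟩ ⟨g, hg, hgy⟩
    exact ⟨fun l => f l + g l, fun l hl => (hf l hl).add (hg l hl),
      fun l hl => by rw [map_add, hfx l hl, hgy l hl]⟩
  smul_mem' := by
    rintro c x ⟨f, hf, hfx⟩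
    exact ⟨fun l => c • f l, fun l hl => analyticAt_const.smul (hf l hl),
      fun l hl => by rw [map_smul, hfx l hl]⟩

/-- The reduced minimum modulus
`γ_T(ζ) = inf {‖(T - ζ) x‖ / dist(x, N(T - ζ)) : x ∉ N(T - ζ)}`, with values in `[0, ∞]`; the
infimum over the empty set, which occurs exactly when `T = ζ`, is `∞`. For `x ∉ N(T - ζ)` the
denominator is positive and finite. -/
def reducedMinModulus (T : X →L[ℂ] X) (z : ℂ) : ℝ≥0∞ :=
  ⨅ (x : X) (_ : x ∉ (shift T z).ker),
    ‖shift T z x‖ₑ / Metric.infEDist x ((shift T z).ker : Set X)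

end SpectralTheory

end

namespace SpectralTheory

variable {X : Type*} [NormedAddCommGroup X] [NormedSpace ℂ X]

/-! At a point `l` of `pi00 T` the operator `T - l` has finite dimensional kernel and is a limit of
invertible operators `T - z`. If its range is closed, stability of the index makes it Fredholm of
index zero (`isWeyl_of_isClosed_range`), so (ii) gives one inclusion of Weyl's theorem. The other
inclusion is automatic under SVEP (`HasSVEP.mem_iso_of_isWeyl`): a finite rank perturbation makes a
Weyl operator invertible, so near `l` the invertibility of `T - z` is decided by an analytic
determinant. If that determinant vanished identically, its null vectors would give an analytic
family of eigenvectors.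

For (iii), let `P` be the Riesz projection at `l`. Its range lies in the glocal subspace, on which
it is the identity. Since `(T - l) B = 1 - P` for a Cauchy integral `B` of the resolvent, `N(P)`
lies in `R(T - l)`; if `P` has finite rank, `R(T - l)` is therefore closed. Conversely `P` is
compact when `T - l` is Weyl, so its fixed space is finite dimensional.

For (iv), the reduced minimum modulus is nonzero exactly when the range is closed, while an
eigenvector at `l` forces it to tend to zero along `z → l`, `z ≠ l`. Continuity at `l` thus means
that the range is not closed. -/

@[simp]
lemma shift_apply (T : X →L[ℂ] X) (z : ℂ) (x : X) : shift T z x = T x - z • x := rfl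

lemma isUnit_shift_iff {T : X →L[ℂ] X} {z : ℂ} : IsUnit (shift T z) ↔ z ∉ spectrum ℂ T := by
  rw [spectrum.notMem_iff, ← IsUnit.neg_iff]
  congr! 1
  ext x
  simp [Algebra.algebraMap_eq_smul_one]

lemma mem_iso_spectrum_iff {T : X →L[ℂ] X} {l : ℂ} :
    l ∈ iso (spectrum ℂ T) ↔ l ∈ spectrum ℂ T ∧ ∀ᶠ z in 𝓝[≠] l, IsUnit (shift T z) := by
  simp only [iso, Set.mem_sdiff, Set.mem_ofPred_eq, accPt_iff_frequently_nhdsNE,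
    Filter.not_frequently, isUnit_shift_iff]

lemma continuous_shift (T : X →L[ℂ] X) : Continuous (shift T) := by
  unfold shift; fun_prop

lemma differentiable_shift (T : X →L[ℂ] X) : Differentiable ℂ (shift T) := by
  unfold shift; fun_prop

/-! ### Stability of the index under approximation by invertible operators -/

section IndexCount

variable {T : X →L[ℂ] X} {l : ℂ}

/-- The map `(x, w) ↦ (T - z) x + w` on the product of two subspaces. -/
def borderedMap (T : X →L[ℂ] X) (X₁ W : Submodule ℂ X) (z : ℂ) : X₁ × W →L[ℂ] X :=
  ((shift T z) ∘L X₁.subtypeL).coprod W.subtypeL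

@[simp]
lemma borderedMap_apply (T : X →L[ℂ] X) (X₁ W : Submodule ℂ X) (z : ℂ) (p : X₁ × W) :
    borderedMap T X₁ W z p = shift T z p.1 + p.2 := rfl

lemma continuous_borderedMap (T : X →L[ℂ] X) (X₁ W : Submodule ℂ X) :
    Continuous (borderedMap T X₁ W) := by
  have h : borderedMap T X₁ W = fun z => borderedMap T X₁ W 0 -
      z • (X₁.subtypeL ∘L ContinuousLinearMap.fst ℂ X₁ W) := by
    funext z
    ext p <;> simp
  rw [h]
  fun_prop

lemma borderedMap_injective {X₁ W : Submodule ℂ X} (hX₁ : Disjoint (shift T l).ker X₁)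
    (hW : Disjoint (shift T l).range W) : Function.Injective (borderedMap T X₁ W l) := by
  rw [injective_iff_map_eq_zero]
  rintro ⟨⟨x, hx⟩, ⟨w, hw⟩⟩ h
  rw [borderedMap_apply] at h
  have hw0 : w = 0 := by
    refine Submodule.disjoint_def.1 hW w ⟨-x, ?_⟩ hw
    simp only [map_neg]
    exact neg_eq_of_add_eq_zero_right h
  subst hw0
  have hx0 : x = 0 := Submodule.disjoint_def.1 hX₁ x (by simpa using h) hx
  subst hx0
  rfl

lemma range_borderedMap {X₁ W : Submodule ℂ X} (hX₁ : Codisjoint (shift T l).ker X₁) :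
    (borderedMap T X₁ W l).range = (shift T l).range ⊔ W := by
  refine le_antisymm ?_ (sup_le ?_ ?_)
  · rintro _ ⟨p, rfl⟩
    exact Submodule.add_mem_sup ⟨_, rfl⟩ p.2.2
  · rintro _ ⟨x, rfl⟩
    obtain ⟨y, hy, z, hz, rfl⟩ := Submodule.mem_sup.1 (hX₁.eq_top ▸ Submodule.mem_top (x := x))
    refine ⟨(⟨z, hz⟩, 0), ?_⟩
    have hy' : shift T l y = 0 := hy
    change shift T l z + 0 = shift T l (y + z)
    rw [map_add, hy', zero_add, add_zero]
  · rintro w hw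
    exact ⟨(0, ⟨w, hw⟩), by simp⟩

/-- An injective operator with closed range stays injective under small perturbations. -/
lemma eventually_injective {E F : Type*} [NormedAddCommGroup E] [NormedSpace ℂ E] [CompleteSpace E]
    [NormedAddCommGroup F] [NormedSpace ℂ F] [CompleteSpace F] {Φ : ℂ → E →L[ℂ] F}
    (hΦ : ContinuousAt Φ l) (hinj : Function.Injective (Φ l))
    (hcl : IsClosed (Set.range (Φ l))) : ∀ᶠ z in 𝓝 l, Function.Injective (Φ z) := by
  obtain ⟨K, hK0, hK⟩ : ∃ K : ℝ, 0 < K ∧ ∀ x, ‖x‖ ≤ K * ‖Φ l x‖ := by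
    obtain ⟨K, hK⟩ := (Φ l).antilipschitz_of_injective_of_isClosed_range hinj hcl
    refine ⟨K + 1, by positivity, fun x => ?_⟩
    have h1 := hK.le_mul_dist x 0
    simp only [dist_zero_right, map_zero] at h1
    nlinarith [norm_nonneg (Φ l x)]
  have hev : ∀ᶠ z in 𝓝 l, ‖Φ z - Φ l‖ < K⁻¹ := by
    have := (hΦ.sub continuousAt_const).norm (f := fun z => Φ z - Φ l)
    exact this.eventually_lt continuousAt_const (by simpa using hK0)
  filter_upwards [hev] with z hz
  rw [injective_iff_map_eq_zero]
  intro x hx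
  by_contra hx0
  have hxpos : 0 < ‖x‖ := norm_pos_iff.2 hx0
  have h1 : ‖Φ l x‖ ≤ ‖Φ z - Φ l‖ * ‖x‖ := by
    have := (Φ z - Φ l).le_opNorm x
    simpa [hx] using this
  have h2 : ‖x‖ ≤ K * (‖Φ z - Φ l‖ * ‖x‖) := (hK x).trans (by gcongr)
  have h3 : K * ‖Φ z - Φ l‖ < 1 := by
    calc K * ‖Φ z - Φ l‖ < K * K⁻¹ := by gcongr
      _ = 1 := mul_inv_cancel₀ hK0.ne'
  nlinarith

variable [CompleteSpace X]

/-- With `X₁` a closed complement of the kernel, the bordered map is injective with closed range at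
`l`, hence injective at a nearby `z` with `T - z` invertible. There `(T - z)⁻¹ W` meets `X₁` only in
zero, so `W` embeds in `X / X₁`, which is isomorphic to the kernel at `l`. -/
lemma finrank_le_finrank_ker [FiniteDimensional ℂ (shift T l).ker]
    (hcl : IsClosed ((shift T l).range : Set X)) (hu : ∃ᶠ z in 𝓝 l, IsUnit (shift T z))
    (W : Submodule ℂ X) [FiniteDimensional ℂ W] (hW : Disjoint (shift T l).range W) :
    Module.finrank ℂ W ≤ Module.finrank ℂ (shift T l).ker := by
  obtain ⟨X₁, hX₁⟩ := (Submodule.ClosedComplemented.of_finiteDimensional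
    (shift T l).ker).exists_isTopCompl
  have hc : IsClosed (X₁ : Set X) := hX₁.symm.isClosed
  have : CompleteSpace X₁ := hc.completeSpace_coe
  have hev := eventually_injective (continuous_borderedMap T X₁ W).continuousAt
    (borderedMap_injective hX₁.isCompl.disjoint hW) (by
      have := Submodule.isClosed_sup_finiteDimensional _ W hcl
      rwa [← range_borderedMap hX₁.isCompl.codisjoint] at this)
  obtain ⟨z, ⟨u, hu⟩, hinj⟩ := (hu.and_eventually hev).exists
  have hur : ∀ y, shift T z ((↑u⁻¹ : X →L[ℂ] X) y) = y := fun y => by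
    rw [← hu, ← mul_apply_eq_comp, Units.mul_inv, one_apply_eq_self]
  rw [← (Submodule.quotientEquivOfIsCompl X₁ (shift T l).ker hX₁.isCompl.symm).finrank_eq]
  have : FiniteDimensional ℂ (X ⧸ X₁) :=
    (Submodule.quotientEquivOfIsCompl X₁ (shift T l).ker hX₁.isCompl.symm).symm.finiteDimensional
  refine LinearMap.finrank_le_finrank_of_injective
    (f := X₁.mkQ ∘ₗ (↑u⁻¹ : X →L[ℂ] X).toLinearMap ∘ₗ W.subtype) ?_
  rw [injective_iff_map_eq_zero]
  intro w hw
  have hm : (↑u⁻¹ : X →L[ℂ] X) w ∈ X₁ := by simpa using hw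
  have := @hinj (-⟨_, hm⟩, w) 0 (by
    rw [borderedMap_apply, map_zero]
    simp only [Submodule.coe_neg, map_neg, hur]
    simp)
  exact (Prod.mk.inj this).2

/-- Dual count: the bordered map is now bijective at `l`, and isomorphisms form an open set. At a
nearby `z` with `T - z` invertible, `X = X₁ + (T - z)⁻¹ W`, so `W` maps onto `X / X₁`. -/
lemma finrank_ker_le_finrank [FiniteDimensional ℂ (shift T l).ker]
    (hu : ∃ᶠ z in 𝓝 l, IsUnit (shift T z))
    (W : Submodule ℂ X) [FiniteDimensional ℂ W] (hW : IsCompl (shift T l).range W) :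
    Module.finrank ℂ (shift T l).ker ≤ Module.finrank ℂ W := by
  obtain ⟨X₁, hX₁⟩ := (Submodule.ClosedComplemented.of_finiteDimensional
    (shift T l).ker).exists_isTopCompl
  have hc : IsClosed (X₁ : Set X) := hX₁.symm.isClosed
  have : CompleteSpace X₁ := hc.completeSpace_coe
  have hinj := borderedMap_injective hX₁.isCompl.disjoint hW.disjoint
  have hev : ∀ᶠ z in 𝓝 l, borderedMap T X₁ W z ∈
      Set.range ((↑) : ((X₁ × W) ≃L[ℂ] X) → (X₁ × W) →L[ℂ] X) := by
    refine (continuous_borderedMap T X₁ W).continuousAt.eventually_mem ?_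
    rw [← ContinuousLinearEquiv.coe_ofBijective (borderedMap T X₁ W l)
      (LinearMap.ker_eq_bot.2 hinj) (by
        rw [range_borderedMap hX₁.isCompl.codisjoint, hW.codisjoint.eq_top])]
    exact ContinuousLinearEquiv.nhds _
  obtain ⟨z, ⟨u, hu⟩, e, he⟩ := (hu.and_eventually hev).exists
  have hul : ∀ y, (↑u⁻¹ : X →L[ℂ] X) (shift T z y) = y := fun y => by
    rw [← hu, ← mul_apply_eq_comp, Units.inv_mul, one_apply_eq_self]
  rw [← (Submodule.quotientEquivOfIsCompl X₁ (shift T l).ker hX₁.isCompl.symm).finrank_eq]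
  refine LinearMap.finrank_le_finrank_of_surjective
    (f := X₁.mkQ ∘ₗ (↑u⁻¹ : X →L[ℂ] X).toLinearMap ∘ₗ W.subtype) ?_
  intro q
  obtain ⟨y, rfl⟩ := X₁.mkQ_surjective q
  obtain ⟨p, hp⟩ := e.surjective (shift T z y)
  have hp' : shift T z p.1 + p.2 = shift T z y := by
    rw [← hp, ← borderedMap_apply, ← he]; rfl
  refine ⟨p.2, ?_⟩
  have h2 : (↑u⁻¹ : X →L[ℂ] X) p.2 = y - p.1 := by
    rw [← hul (y - p.1), map_sub (shift T z), ← hp', add_sub_cancel_left]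
  simp only [LinearMap.comp_apply, Submodule.subtype_apply, ContinuousLinearMap.coe_coe, h2,
    map_sub]
  simp

/-- A closed range operator with finite dimensional kernel which is a limit of invertible operators
`T - z` is Fredholm of index zero. -/
theorem isWeyl_of_isClosed_range [FiniteDimensional ℂ (shift T l).ker]
    (hcl : IsClosed ((shift T l).range : Set X)) (hu : ∃ᶠ z in 𝓝 l, IsUnit (shift T z)) :
    IsWeyl (shift T l) := by
  obtain ⟨W, hW⟩ := (shift T l).range.exists_isCompl
  -- Finite codimension is not yet known, so the bound is applied to spans of finite independent
  -- subsets of `W`.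
  have hr : Module.rank ℂ W ≤ (Module.finrank ℂ (shift T l).ker : ℕ) := by
    refine rank_le fun s hs => ?_
    have hc := finrank_span_eq_card (hs.map' W.subtype W.ker_subtype)
    have hle : Submodule.span ℂ (Set.range (W.subtype ∘ fun i : s => (i : W))) ≤ W := by
      rw [Submodule.span_le]
      rintro _ ⟨i, rfl⟩
      exact i.1.2
    rw [← Fintype.card_coe, ← hc]
    have : FiniteDimensional ℂ (Submodule.span ℂ (Set.range (W.subtype ∘ fun i : s => (i : W)))) :=
      FiniteDimensional.span_of_finite ℂ (Set.finite_range _)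
    exact finrank_le_finrank_ker hcl hu _ (hW.disjoint.mono_right hle)
  have : FiniteDimensional ℂ W :=
    Module.rank_lt_aleph0_iff.1 (hr.trans_lt Cardinal.natCast_lt_aleph0)
  have hq : FiniteDimensional ℂ (X ⧸ (shift T l).range) :=
    (Submodule.quotientEquivOfIsCompl _ W hW).symm.finiteDimensional
  refine ⟨⟨?_, hcl, inferInstance, hq, .of_finiteDimensional _⟩, ?_⟩
  · rw [Topology.isStrictMap_iff_isQuotientMap_rangeFactorization]
    have : CompleteSpace (shift T l).range := hcl.completeSpace_coe
    exact (((shift T l).codRestrict (shift T l).range fun x => ⟨x, rfl⟩).isQuotientMap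
      (fun y => by obtain ⟨_, x, rfl⟩ := y; exact ⟨x, rfl⟩))
  · rw [(Submodule.quotientEquivOfIsCompl _ W hW).finrank_eq, sub_eq_zero, Nat.cast_inj]
    exact (finrank_ker_le_finrank hu W hW).antisymm (finrank_le_finrank_ker hcl hu W hW.disjoint)

end IndexCount

/-! ### Analytic null vectors of singular analytic matrices -/

section AnalyticKernel

/-- The ring of functions on `U` which extend to functions analytic near every point of `U`. -/
def analyticSubring (U : Set ℂ) : Subring (U → ℂ) where
  carrier := {f | ∃ g : ℂ → ℂ, AnalyticOnNhd ℂ g U ∧ ∀ z : U, f z = g z}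
  mul_mem' := by
    rintro _ _ ⟨f, hf, hf'⟩ ⟨g, hg, hg'⟩
    exact ⟨_, hf.mul hg, fun z => by simp [hf', hg']⟩
  one_mem' := ⟨fun _ => 1, analyticOnNhd_const, fun _ => rfl⟩
  add_mem' := by
    rintro _ _ ⟨f, hf, hf'⟩ ⟨g, hg, hg'⟩
    exact ⟨_, hf.add hg, fun z => by simp [hf', hg']⟩
  zero_mem' := ⟨fun _ => 0, analyticOnNhd_const, fun _ => rfl⟩
  neg_mem' := by
    rintro _ ⟨f, hf, hf'⟩
    exact ⟨_, hf.neg, fun z => by simp [hf']⟩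

lemma isDomain_analyticSubring {U : Set ℂ} (hU : IsPreconnected U) (hne : U.Nonempty) :
    IsDomain (analyticSubring U) := by
  have : Nontrivial (analyticSubring U) := by
    obtain ⟨z, hz⟩ := hne
    refine ⟨0, 1, fun h => ?_⟩
    simpa using congrFun (congrArg Subtype.val h) ⟨z, hz⟩
  have : NoZeroDivisors (analyticSubring U) := by
    refine ⟨?_⟩
    rintro ⟨a, f, hf, hf'⟩ ⟨b, g, hg, hg'⟩ hab
    have h0 : ∀ z ∈ U, f z * g z = 0 := fun z hz => by
      have := congrFun (congrArg Subtype.val hab) ⟨z, hz⟩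
      simpa [hf', hg'] using this
    refine (hf.eq_zero_or_eq_zero_of_mul_eq_zero hg h0 hU).imp (fun h => ?_) (fun h => ?_)
    · ext z; simpa [hf'] using h z z.2
    · ext z; simpa [hg'] using h z z.2
  exact NoZeroDivisors.to_isDomain _

/-- An analytic family of singular matrices has a nonzero analytic family of null vectors. -/
theorem exists_analytic_mulVec_eq_zero {ι : Type*} [Fintype ι] [DecidableEq ι] {U : Set ℂ}
    (hU : IsPreconnected U) (hne : U.Nonempty) {M : ℂ → Matrix ι ι ℂ}
    (hM : ∀ i j, AnalyticOnNhd ℂ (fun z => M z i j) U) (hdet : ∀ z ∈ U, (M z).det = 0) :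
    ∃ v : ℂ → ι → ℂ, AnalyticOnNhd ℂ v U ∧ (∃ z ∈ U, v z ≠ 0) ∧
      ∀ z ∈ U, (M z).mulVec (v z) = 0 := by
  have := isDomain_analyticSubring hU hne
  -- Over the integral domain of analytic functions the determinant is zero, so a nonzero null
  -- vector exists over that domain.
  let N : Matrix ι ι (analyticSubring U) :=
    Matrix.of fun i j => ⟨fun z => M z i j, _, hM i j, fun _ => rfl⟩
  let ev (z : U) : analyticSubring U →+* ℂ := (Pi.evalRingHom _ z).comp (analyticSubring U).subtype
  have hNM (z : U) : N.map (ev z) = M z := rfl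
  have hN : N.det = 0 := by
    ext z
    have h := (ev z).map_det N
    rw [RingHom.mapMatrix_apply, hNM, hdet z z.2] at h
    exact h
  obtain ⟨w, hw0, hw⟩ := Matrix.exists_mulVec_eq_zero_iff.2 hN
  choose g hg hg' using fun i => (w i).2
  refine ⟨fun z i => g i z, fun z hz => ?_, ?_, fun z hz => ?_⟩
  · exact AnalyticAt.pi fun i => hg i z hz
  · by_contra! h
    refine hw0 (funext fun i => Subtype.ext (funext fun z => ?_))
    rw [hg' i z]
    exact congrFun (h z z.2) i
  · have h := RingHom.map_mulVec (ev ⟨z, hz⟩) N w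
    ext i
    have h1 := h i
    rw [hNM, hw] at h1
    simp only [Pi.zero_apply, map_zero] at h1
    rw [Pi.zero_apply, h1]
    congr 1
    ext j
    exact (hg' j ⟨z, hz⟩).symm

end AnalyticKernel

/-! ### Finite rank perturbation and isolation of Weyl points -/

section Bordering

lemma inverse_apply_apply {A : X →L[ℂ] X} (hA : IsUnit A) (x : X) : Ring.inverse A (A x) = x := by
  rw [← mul_apply_eq_comp, Ring.inverse_mul_cancel _ hA, one_apply_eq_self]

lemma apply_inverse_apply {A : X →L[ℂ] X} (hA : IsUnit A) (x : X) : A (Ring.inverse A x) = x := by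
  rw [← mul_apply_eq_comp, Ring.mul_inverse_cancel _ hA, one_apply_eq_self]

variable {n : ℕ} {J : (Fin n → ℂ) →L[ℂ] X} {Q : X →L[ℂ] (Fin n → ℂ)}

/-- The matrix of the Schur complement `1 - Q (S + J Q)⁻¹ J`, which decides the invertibility
of `S`. -/
noncomputable def schurMatrix (S : X →L[ℂ] X) (J : (Fin n → ℂ) →L[ℂ] X)
    (Q : X →L[ℂ] (Fin n → ℂ)) : Matrix (Fin n) (Fin n) ℂ :=
  LinearMap.toMatrix' (LinearMap.id - (Q ∘L Ring.inverse (S + J ∘L Q) ∘L J).toLinearMap)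

lemma schurMatrix_mulVec (S : X →L[ℂ] X) (v : Fin n → ℂ) :
    (schurMatrix S J Q).mulVec v = v - Q (Ring.inverse (S + J ∘L Q) (J v)) := by
  rw [schurMatrix, LinearMap.toMatrix'_mulVec]
  rfl

variable [CompleteSpace X]

/-- An index zero Fredholm operator becomes invertible after adding a finite rank operator. -/
theorem IsWeyl.exists_isUnit_add {S : X →L[ℂ] X} (hS : IsWeyl S) :
    ∃ (n : ℕ) (J : (Fin n → ℂ) →L[ℂ] X) (Q : X →L[ℂ] (Fin n → ℂ)), IsUnit (S + J ∘L Q) := by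
  obtain ⟨W, hW⟩ := S.range.exists_isCompl
  have := hS.isFredholm.finite_ker
  have hq : FiniteDimensional ℂ (X ⧸ S.range) := hS.isFredholm.finite_coker
  have : FiniteDimensional ℂ W := (Submodule.quotientEquivOfIsCompl _ W hW).finiteDimensional
  have hfr : Module.finrank ℂ S.ker = Module.finrank ℂ W := by
    rw [← (Submodule.quotientEquivOfIsCompl _ W hW).finrank_eq]
    have := hS.index_eq_zero
    omega
  let e : S.ker ≃ₗ[ℂ] W := LinearEquiv.ofFinrankEq _ _ hfr
  let φ : S.ker ≃ₗ[ℂ] (Fin (Module.finrank ℂ S.ker) → ℂ) := LinearEquiv.ofFinrankEq _ _ (by simp)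
  obtain ⟨p, hp⟩ := hS.isFredholm.closedComplemented_ker
  -- The perturbation `J Q` is `e ∘ p`: project onto the kernel, then map it isomorphically onto a
  -- complement of the range.
  refine ⟨_, LinearMap.toContinuousLinearMap (W.subtype ∘ₗ e.toLinearMap ∘ₗ φ.symm.toLinearMap),
    φ.toLinearMap.toContinuousLinearMap ∘L p, ?_⟩
  rw [ContinuousLinearMap.isUnit_iff_bijective]
  set A := S + _
  have hA : ∀ x, A x = S x + e (p x) := fun x => by simp [A]
  constructor
  · rw [injective_iff_map_eq_zero]
    intro x hx
    rw [hA] at hx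
    have h1 : S x = 0 := Submodule.disjoint_def.1 hW.disjoint _ ⟨x, rfl⟩ (by
      rw [eq_neg_of_add_eq_zero_left hx]
      exact W.neg_mem (e (p x)).2)
    have h2 : p x = 0 := by
      rw [h1, zero_add] at hx
      simpa using hx
    have h3 := hp ⟨x, h1⟩
    rw [h2] at h3
    exact (congrArg Subtype.val h3).symm
  · intro y
    obtain ⟨_, ⟨x, rfl⟩, w, hw, rfl⟩ := Submodule.mem_sup.1
      (hW.codisjoint.eq_top ▸ Submodule.mem_top (x := y))
    -- Replacing the kernel component of `x` by `e⁻¹ w` leaves `S x` unchanged and makes the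
    -- perturbation contribute exactly `w`.
    refine ⟨x - p x + e.symm ⟨w, hw⟩, ?_⟩
    have hk (k : S.ker) : S k = 0 := k.2
    rw [hA]
    simp [hk, hp]

variable {T : X →L[ℂ] X}

/-- Write `S = A - J Q` with `A` invertible. If `S x = 0` then `x = A⁻¹ J Q x`, so `Q x` is a null
vector of the Schur matrix. To solve `S x = y`, take `x = A⁻¹ (y + J v)`, where `v` is chosen so
that `Q x = v`. -/
lemma isUnit_of_det_schurMatrix_ne_zero {S : X →L[ℂ] X} (hA : IsUnit (S + J ∘L Q))
    (hd : (schurMatrix S J Q).det ≠ 0) : IsUnit S := by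
  set A := S + J ∘L Q with hAdef
  have hSA (x : X) : S x = A x - J (Q x) := by simp [hAdef]
  rw [ContinuousLinearMap.isUnit_iff_bijective]
  constructor
  · rw [injective_iff_map_eq_zero]
    intro x hx
    have hx' : A x = J (Q x) := by rw [hSA, sub_eq_zero] at hx; exact hx
    have hQ : Q x = 0 := by
      by_contra hQ
      refine hd (Matrix.exists_mulVec_eq_zero_iff.1 ⟨Q x, hQ, ?_⟩)
      rw [schurMatrix_mulVec, ← hAdef, ← hx', inverse_apply_apply hA, sub_self]
    rw [← inverse_apply_apply hA x, hx', hQ, map_zero, map_zero]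
  · intro y
    obtain ⟨v, hv⟩ := Matrix.mulVec_surjective_iff_isUnit.2
      ((Matrix.isUnit_iff_isUnit_det _).2 hd.isUnit) (Q (Ring.inverse A y))
    rw [schurMatrix_mulVec, ← hAdef] at hv
    refine ⟨Ring.inverse A (y + J v), ?_⟩
    rw [hSA, apply_inverse_apply hA]
    have : Q (Ring.inverse A (y + J v)) = v := by rw [map_add, map_add, ← hv]; abel
    rw [this, add_sub_cancel_right]

lemma differentiableOn_inverse {A : ℂ → X →L[ℂ] X} {U : Set ℂ} (hA : Differentiable ℂ A)
    (hU : ∀ z ∈ U, IsUnit (A z)) : DifferentiableOn ℂ (fun z => Ring.inverse (A z)) U :=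
  fun z hz =>
    ((differentiableAt_inverse (𝕜 := ℂ) (hU z hz)).comp z
      hA.differentiableAt).differentiableWithinAt

/-- For an operator with the single valued extension property, every point of the spectrum at which
`T - z` is Fredholm of index zero is isolated in the spectrum. -/
theorem HasSVEP.mem_iso_of_isWeyl (hT : HasSVEP T) {l : ℂ} (hl : l ∈ spectrum ℂ T)
    (hW : IsWeyl (shift T l)) : l ∈ iso (spectrum ℂ T) := by
  obtain ⟨n, J, Q, hu⟩ := hW.exists_isUnit_add
  have hdA : Differentiable ℂ (fun z => shift T z + J ∘L Q) :=
    (differentiable_shift T).add_const _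
  have hev : ∀ᶠ z in 𝓝 l, IsUnit (shift T z + J ∘L Q) :=
    hdA.continuous.continuousAt.eventually_mem (Units.isOpen.mem_nhds hu)
  obtain ⟨r, hr, hball⟩ := Metric.eventually_nhds_iff_ball.1 hev
  have hinv := differentiableOn_inverse hdA hball
  have hent (i j) : AnalyticOnNhd ℂ (fun z => schurMatrix (shift T z) J Q i j)
      (Metric.ball l r) := by
    refine DifferentiableOn.analyticOnNhd ?_ Metric.isOpen_ball
    have h1 : DifferentiableOn ℂ
        (fun z => Q (Ring.inverse (shift T z + J ∘L Q) (J (Pi.single j 1)))) (Metric.ball l r) :=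
      Q.differentiable.comp_differentiableOn (hinv.clm_apply (differentiableOn_const _))
    have h2 : (fun z => schurMatrix (shift T z) J Q i j) = fun z => (Pi.single j 1 : Fin n → ℂ) i -
        Q (Ring.inverse (shift T z + J ∘L Q) (J (Pi.single j 1))) i := by
      funext z
      rw [schurMatrix, LinearMap.toMatrix'_apply]
      rfl
    rw [h2]
    exact (differentiableOn_const _).sub (differentiableOn_pi.1 h1 i)
  have hdet : AnalyticAt ℂ (fun z => (schurMatrix (shift T z) J Q).det) l := by
    simp only [Matrix.det_apply']
    refine Finset.analyticAt_fun_sum _ fun σ _ => ?_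
    exact analyticAt_const.mul
      (Finset.analyticAt_fun_prod _ fun i _ => hent _ _ l (Metric.mem_ball_self hr))
  rw [mem_iso_spectrum_iff]
  refine ⟨hl, ?_⟩
  -- Either the determinant vanishes near `l`, or its zeros do not accumulate at `l`. In the first
  -- case analytic null vectors `v` give `f = A⁻¹ J v` with `Q f = v`, hence `(T - z) f = J v - J Q
  -- f = 0`; SVEP forces `f = 0`, and then `v = Q f = 0`.
  rcases hdet.eventually_eq_zero_or_eventually_ne_zero with h0 | h0
  · exfalso
    obtain ⟨s, hs, hball'⟩ := Metric.eventually_nhds_iff_ball.1 (h0.and (Metric.ball_mem_nhds l hr))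
    have hsub : Metric.ball l s ⊆ Metric.ball l r := fun z hz => (hball' z hz).2
    obtain ⟨v, hv, ⟨z, hz, hvz⟩, hMv⟩ := exists_analytic_mulVec_eq_zero
      (convex_ball l s).isPreconnected ⟨l, Metric.mem_ball_self hs⟩
      (fun i j => (hent i j).mono hsub) (fun z hz => (hball' z hz).1)
    have hQv : ∀ z ∈ Metric.ball l s,
        Q (Ring.inverse (shift T z + J ∘L Q) (J (v z))) = v z := fun z hz => by
      have := hMv z hz
      rw [schurMatrix_mulVec, sub_eq_zero] at this
      exact this.symm
    have := hT (Metric.ball l s) Metric.isOpen_ball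
      (fun z => Ring.inverse (shift T z + J ∘L Q) (J (v z)))
      (((hinv.mono hsub).clm_apply
        (J.differentiable.comp_differentiableOn hv.differentiableOn)).analyticOnNhd
          Metric.isOpen_ball) (fun z hz => by
        have h1 := apply_inverse_apply (hball z (hsub hz)) (J (v z))
        rw [add_apply, ContinuousLinearMap.comp_apply, hQv z hz] at h1
        simpa using h1) z hz
    apply hvz
    rw [← hQv z hz, this, map_zero]
  · filter_upwards [h0, hev.filter_mono nhdsWithin_le_nhds] with z hz hz'
    exact isUnit_of_det_schurMatrix_ne_zero hz' hz

end Bordering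

open Real Metric MeasureTheory
open Complex (I)

/-! ### Vector-valued circle integrals -/

section CircleIntegral

variable {E F : Type*} [NormedAddCommGroup E] [NormedSpace ℂ E]
  [NormedAddCommGroup F] [NormedSpace ℂ F]

lemma clm_circleIntegral_comp_comm [CompleteSpace E] [CompleteSpace F] (L : E →L[ℂ] F)
    {f : ℂ → E} {c : ℂ} {R : ℝ} (hf : CircleIntegrable f c R) :
    (∮ z in C(c, R), L (f z)) = L (∮ z in C(c, R), f z) := by
  rw [circleIntegral, circleIntegral, ← L.intervalIntegral_comp_comm hf.out]
  simp

lemma circleIntegral_mem [CompleteSpace E] {K : Submodule ℂ E} (hK : IsClosed (K : Set E))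
    {f : ℂ → E} {c : ℂ} {R : ℝ} (hR : 0 ≤ R) (hf : CircleIntegrable f c R)
    (hfK : ∀ z ∈ sphere c R, f z ∈ K) : (∮ z in C(c, R), f z) ∈ K := by
  have : IsClosed (K.toAddSubgroup : Set E) := hK
  have h := clm_circleIntegral_comp_comm K.mkQL hf
  rw [← Submodule.Quotient.mk_eq_zero]
  refine h.symm.trans ?_
  -- The integral is pushed to the quotient by `K`, where the integrand vanishes on the circle.
  rw [circleIntegral.integral_congr (f := fun z => K.mkQL (f z)) (g := fun _ => 0) hR fun z hz =>
    (Submodule.Quotient.mk_eq_zero K).2 (hfK z hz)]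
  simp [circleIntegral]

/-- The Cauchy integral over a circle is holomorphic outside the closed disc. -/
lemma differentiableAt_cauchyIntegral {g : ℂ → E} {c : ℂ} {r : ℝ} (hr : 0 ≤ r)
    (hg : ContinuousOn g (sphere c r)) {z₀ : ℂ} (hz₀ : r < dist z₀ c) :
    DifferentiableAt ℂ (fun z => ∮ w in C(c, r), (w - z)⁻¹ • g w) z₀ := by
  -- Half the gap between `z₀` and the circle: every point of `ball z₀ ε` stays at distance at least
  -- `ε` from the circle.
  set ε := (dist z₀ c - r) / 2 with hε
  have hε0 : 0 < ε := by linarith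
  have hlow : ∀ z ∈ ball z₀ ε, ∀ θ : ℝ, ε ≤ ‖circleMap c r θ - z‖ := fun z hz θ => by
    have h1 : dist (circleMap c r θ) c = r := circleMap_mem_sphere c hr θ
    have h2 := dist_triangle z₀ z c
    have h3 := dist_triangle z (circleMap c r θ) c
    rw [mem_ball, dist_comm] at hz
    rw [← dist_eq_norm, dist_comm]
    linarith
  have hne : ∀ z ∈ ball z₀ ε, ∀ θ : ℝ, circleMap c r θ - z ≠ 0 := fun z hz θ =>
    norm_pos_iff.1 (hε0.trans_le (hlow z hz θ))
  have hgc : Continuous fun θ => g (circleMap c r θ) :=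
    hg.comp_continuous (continuous_circleMap c r) (circleMap_mem_sphere c hr)
  have hd : Continuous (deriv (circleMap c r)) := by
    have : deriv (circleMap c r) = fun θ => circleMap 0 r θ * I := by ext; simp
    rw [this]
    exact (continuous_circleMap 0 r).mul continuous_const
  have hcF : ∀ z ∈ ball z₀ ε, Continuous fun θ : ℝ =>
      deriv (circleMap c r) θ • (circleMap c r θ - z)⁻¹ • g (circleMap c r θ) := fun z hz =>
    hd.smul ((((continuous_circleMap c r).sub continuous_const).inv₀ (hne z hz)).smul hgc)
  have hcF' : Continuous fun θ : ℝ =>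
      deriv (circleMap c r) θ • ((circleMap c r θ - z₀) ^ 2)⁻¹ • g (circleMap c r θ) :=
    hd.smul (((((continuous_circleMap c r).sub continuous_const).pow 2).inv₀ fun θ =>
      pow_ne_zero 2 (hne z₀ (mem_ball_self hε0) θ)).smul hgc)
  refine (intervalIntegral.hasDerivAt_integral_of_dominated_loc_of_deriv_le
    (F := fun z θ => deriv (circleMap c r) θ • (circleMap c r θ - z)⁻¹ • g (circleMap c r θ))
    (F' := fun z θ =>
      deriv (circleMap c r) θ • ((circleMap c r θ - z) ^ 2)⁻¹ • g (circleMap c r θ))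
    (bound := fun θ => ‖deriv (circleMap c r) θ‖ * ((ε ^ 2)⁻¹ * ‖g (circleMap c r θ)‖))
    (ball_mem_nhds z₀ hε0) ?_ ?_ ?_ ?_ ?_ ?_).2.differentiableAt
  · filter_upwards [ball_mem_nhds z₀ hε0] with z hz
    exact (hcF z hz).aestronglyMeasurable
  · exact (hcF z₀ (mem_ball_self hε0)).intervalIntegrable _ _
  · exact hcF'.aestronglyMeasurable
  · refine .of_forall fun θ _ z hz => ?_
    rw [norm_smul, norm_smul, norm_inv, norm_pow]
    gcongr
    exact hlow z hz θ
  · exact (hd.norm.mul (continuous_const.mul hgc.norm)).intervalIntegrable _ _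
  · refine .of_forall fun θ _ z hz => ?_
    have h1 : HasDerivAt (fun z => (circleMap c r θ - z)⁻¹) ((circleMap c r θ - z) ^ 2)⁻¹ z := by
      have := ((hasDerivAt_id' z).const_sub (circleMap c r θ)).fun_inv (hne z hz θ)
      rwa [neg_neg, one_div] at this
    exact (h1.smul_const _).const_smul _

end CircleIntegral

/-! ### The Riesz projection and the glocal spectral subspace -/

section RieszProjection

/-- The Riesz projection `-(2πi)⁻¹ ∮ (T - w)⁻¹ dw` over the circle of centre `l` and radius `r`. -/
noncomputable def rieszProjection (T : X →L[ℂ] X) (l : ℂ) (r : ℝ) : X →L[ℂ] X :=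
  -((2 * π * I : ℂ)⁻¹ • ∮ w in C(l, r), Ring.inverse (shift T w))

/-- The Cauchy integral `(2πi)⁻¹ ∮ (w - z)⁻¹ (T - w)⁻¹ dw` of the resolvent. -/
noncomputable def resolventCauchy (T : X →L[ℂ] X) (l : ℂ) (r : ℝ) (z : ℂ) : X →L[ℂ] X :=
  (2 * π * I : ℂ)⁻¹ • ∮ w in C(l, r), (w - z)⁻¹ • Ring.inverse (shift T w)

variable [CompleteSpace X] {T : X →L[ℂ] X} {l : ℂ} {r : ℝ}

lemma continuousOn_inverse_shift {U : Set ℂ} (hU : ∀ w ∈ U, IsUnit (shift T w)) :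
    ContinuousOn (fun w => Ring.inverse (shift T w)) U :=
  (differentiableOn_inverse (differentiable_shift T) hU).continuousOn

/-- Since `T - z = (T - w) + (w - z)`, applying `T - z` to the integrand gives `(w - z)⁻¹ + (T -
w)⁻¹`. The scalar integral that remains tells `z = l` apart from `z` outside the disc. -/
lemma shift_mul_resolventCauchy (hr : 0 ≤ r) (hu : ∀ w ∈ sphere l r, IsUnit (shift T w)) {z : ℂ}
    (hz : z ∉ sphere l r) :
    shift T z * resolventCauchy T l r z =
      ((2 * π * I : ℂ)⁻¹ * ∮ w in C(l, r), (w - z)⁻¹) • 1 - rieszProjection T l r := by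
  have hci : ContinuousOn (fun w : ℂ => (w - z)⁻¹) (sphere l r) :=
    (continuousOn_id.sub continuousOn_const).inv₀ fun w hw h =>
      hz ((sub_eq_zero.1 h : w = z) ▸ hw)
  have hcR := continuousOn_inverse_shift hu
  have hint : CircleIntegrable (fun w => (w - z)⁻¹ • Ring.inverse (shift T w)) l r :=
    (hci.smul hcR).circleIntegrable hr
  have key := clm_circleIntegral_comp_comm (ContinuousLinearMap.mul ℂ (X →L[ℂ] X) (shift T z)) hint
  have hid : ∀ w ∈ sphere l r,
      ContinuousLinearMap.mul ℂ (X →L[ℂ] X) (shift T z) ((w - z)⁻¹ • Ring.inverse (shift T w)) =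
        (w - z)⁻¹ • (1 : X →L[ℂ] X) + Ring.inverse (shift T w) := fun w hw => by
    have h0 : w - z ≠ 0 := fun h => hz (by rwa [← sub_eq_zero.1 h])
    have h1 : shift T z = shift T w + (w - z) • 1 := by ext x; simp [sub_smul]
    rw [ContinuousLinearMap.mul_apply', mul_smul_comm, h1, add_mul,
      Ring.mul_inverse_cancel _ (hu w hw), smul_mul_assoc, one_mul, smul_add, inv_smul_smul₀ h0]
  have hi1 : CircleIntegrable (fun w => (w - z)⁻¹ • (1 : X →L[ℂ] X)) l r :=
    (hci.smul continuousOn_const).circleIntegrable hr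
  rw [circleIntegral.integral_congr hr hid,
    circleIntegral.integral_add hi1 (hcR.circleIntegrable hr),
    circleIntegral.integral_smul_const, ContinuousLinearMap.mul_apply'] at key
  rw [resolventCauchy, mul_smul_comm, ← key, rieszProjection, smul_add, smul_smul, sub_neg_eq_add]

lemma shift_mul_resolventCauchy_center (hr : 0 < r) (hu : ∀ w ∈ sphere l r, IsUnit (shift T w)) :
    shift T l * resolventCauchy T l r l = 1 - rieszProjection T l r := by
  rw [shift_mul_resolventCauchy hr.le hu (by simpa using hr.ne),
    circleIntegral.integral_sub_center_inv _ hr.ne', inv_mul_cancel₀ Complex.two_pi_I_ne_zero,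
    one_smul]

lemma shift_mul_resolventCauchy_of_lt (hr : 0 ≤ r) (hu : ∀ w ∈ sphere l r, IsUnit (shift T w))
    {z : ℂ} (hz : r < dist z l) :
    shift T z * resolventCauchy T l r z = -rieszProjection T l r := by
  have hne : ∀ w ∈ closedBall l r, w - z ≠ 0 := fun w hw h => by
    rw [sub_eq_zero.1 h] at hw
    exact hz.not_ge hw
  have h0 : (∮ w in C(l, r), (w - z)⁻¹) = 0 :=
    Complex.circleIntegral_eq_zero_of_differentiable_on_off_countable hr Set.countable_empty
      ((continuousOn_id.sub continuousOn_const).inv₀ hne)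
      (fun w hw => (differentiableAt_id.sub_const z).inv (hne w (ball_subset_closedBall hw.1)))
  rw [shift_mul_resolventCauchy hr hu (fun h => hz.ne' h), h0]
  simp

/-- The range of the Riesz projection is contained in the glocal spectral subspace. -/
lemma rieszProjection_mem_glocalSubspace {R : ℝ} (hr : 0 < r) (hrR : r < R)
    (hu : ∀ w ∈ ball l R, w ≠ l → IsUnit (shift T w)) (x : X) :
    rieszProjection T l r x ∈ glocalSubspace T {l} := by
  have hus : ∀ w ∈ sphere l r, IsUnit (shift T w) := fun w hw =>
    hu w (mem_ball.2 (mem_sphere.1 hw ▸ hrR)) (by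
      rintro rfl
      exact hr.ne (by simpa using hw))
  have hC : ∀ z, r < dist z l →
      shift T z (-resolventCauchy T l r z x) = rieszProjection T l r x := fun z hz => by
    rw [map_neg, ← mul_apply_eq_comp, shift_mul_resolventCauchy_of_lt hr.le hus hz, neg_apply,
      neg_neg]
  have hdC : AnalyticOnNhd ℂ (fun z => -resolventCauchy T l r z x) {z | r < dist z l} := by
    refine DifferentiableOn.analyticOnNhd (fun z hz => ?_)
      (isOpen_lt continuous_const (continuous_id.dist continuous_const))
    exact (((differentiableAt_cauchyIntegral hr.le (continuousOn_inverse_shift hus) hz).const_smul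
      (2 * π * I : ℂ)⁻¹).clm_apply (differentiableAt_const x)).neg.differentiableWithinAt
  have hdR : AnalyticOnNhd ℂ (fun z => Ring.inverse (shift T z) (rieszProjection T l r x))
      (ball l R \ {l}) :=
    ((differentiableOn_inverse (differentiable_shift T) fun w hw => hu w hw.1 hw.2).clm_apply
      (differentiableOn_const _)).analyticOnNhd (isOpen_ball.sdiff isClosed_singleton)
  classical
  -- The resolvent inside the large disc is glued to the Cauchy integral outside it; both solve the
  -- same equation on the annulus `r < |z - l| < R`, where `T - z` is invertible, so they agree
  -- there.
  refine ⟨fun z => if z ∈ ball l R then Ring.inverse (shift T z) (rieszProjection T l r x)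
    else -resolventCauchy T l r z x, fun z hz => ?_, fun z hz => ?_⟩
  · by_cases hzR : z ∈ ball l R
    · refine (hdR z ⟨hzR, hz⟩).congr ?_
      filter_upwards [isOpen_ball.mem_nhds hzR] with w hw
      rw [if_pos hw]
    · have hzr : r < dist z l := hrR.trans_le (not_lt.1 hzR)
      refine (hdC z hzr).congr ?_
      filter_upwards [(isOpen_lt continuous_const (continuous_id.dist continuous_const)).mem_nhds
        hzr] with w hw
      have hw' : r < dist w l := hw
      split_ifs with hwR
      · rw [← hC w hw', inverse_apply_apply (hu w hwR (dist_pos.1 (hr.trans hw')))]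
      · rfl
  · dsimp only
    split_ifs with hzR
    · exact apply_inverse_apply (hu z hzR hz) _
    · exact hC z (hrR.trans_le (not_lt.1 hzR))

/-- On the glocal spectral subspace, the Riesz projection is the identity. -/
lemma rieszProjection_apply_of_mem (hr : 0 < r)
    (hu : ∀ w ∈ sphere l r, IsUnit (shift T w)) {x : X}
    (hx : x ∈ glocalSubspace T {l}) : rieszProjection T l r x = x := by
  obtain ⟨f, hf, hfx⟩ := hx
  have hcR := continuousOn_inverse_shift hu
  have hne : ∀ R : ℝ, 0 < R → ∀ w ∈ sphere l R, w ≠ l := fun R hR w hw h => by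
    rw [h, mem_sphere, dist_self] at hw
    exact hR.ne hw
  have hfc : ∀ R : ℝ, 0 < R → ContinuousOn f (sphere l R) := fun R hR =>
    hf.continuousOn.mono (hne R hR)
  have h1 : (∮ w in C(l, r), Ring.inverse (shift T w)) x = ∮ w in C(l, r), f w := by
    have := clm_circleIntegral_comp_comm (ContinuousLinearMap.apply ℂ X x)
      (hcR.circleIntegrable hr.le)
    rw [ContinuousLinearMap.apply_apply] at this
    rw [← this]
    refine circleIntegral.integral_congr hr.le fun w hw => ?_
    rw [ContinuousLinearMap.apply_apply, ← hfx w (hne r hr w hw), inverse_apply_apply (hu w hw)]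
  -- On the small circle `f` is the resolvent applied to `x`, but `f` is analytic on all of `ℂ \
  -- {l}`, so the contour can be enlarged without meeting the rest of the spectrum.
  have h2 : ∀ R, r ≤ R → (∮ w in C(l, R), f w) = ∮ w in C(l, r), f w := fun R hR => by
    refine Complex.circleIntegral_eq_of_differentiable_on_annulus_off_countable hr hR
      Set.countable_empty ?_ ?_
    · refine hf.continuousOn.mono ?_
      rintro w ⟨-, hw⟩ rfl
      exact hw (mem_ball_self hr)
    · rintro w ⟨⟨-, hw⟩, -⟩
      refine (hf w ?_).differentiableAt
      rintro rfl
      exact hw (mem_closedBall_self hr.le)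
  set S := shift T l
  have hSf : ∀ w, w ≠ l → (w - l) • f w = S (f w) - x := fun w hw => by
    conv_rhs => rw [← hfx w hw]
    simp only [S, shift_apply, sub_smul]
    abel
  -- As `R → ∞`, `f w` behaves like `-(w - l)⁻¹ x`. The error is `(w - l)⁻¹ S (f w)`, whose integral
  -- is of order `1 / R`.
  have h3 : ∀ R, max r ‖S‖ < R →
      ‖(∮ w in C(l, r), f w) + (2 * π * I : ℂ) • x‖ ≤ (2 * π * (‖S‖ * ‖x‖)) * (R - ‖S‖)⁻¹ := by
    intro R hR
    have hrR : r < R := (le_max_left _ _).trans_lt hR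
    have hSR : 0 < R - ‖S‖ := sub_pos.2 ((le_max_right _ _).trans_lt hR)
    have hR0 : 0 < R := hr.trans hrR
    have hci : ContinuousOn (fun w : ℂ => (w - l)⁻¹) (sphere l R) :=
      (continuousOn_id.sub continuousOn_const).inv₀ fun w hw => sub_ne_zero.2 (hne R hR0 w hw)
    have h4 : (∮ w in C(l, r), f w) + (2 * π * I : ℂ) • x =
        ∮ w in C(l, R), (w - l)⁻¹ • S (f w) := by
      have hi : CircleIntegrable (fun w => (w - l)⁻¹ • x) l R :=
        (hci.smul continuousOn_const).circleIntegrable hR0.le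
      rw [← h2 R hrR.le, ← circleIntegral.integral_sub_center_inv l hR0.ne',
        ← circleIntegral.integral_smul_const, ← circleIntegral.integral_add
          ((hfc R hR0).circleIntegrable hR0.le) hi]
      refine circleIntegral.integral_congr hR0.le fun w hw => ?_
      have hwl := hne R hR0 w hw
      have : S (f w) = (w - l) • f w + x := by rw [hSf w hwl, sub_add_cancel]
      simp only [this, smul_add, inv_smul_smul₀ (sub_ne_zero.2 hwl)]
    rw [h4]
    have h5 : ∀ w ∈ sphere l R, ‖(w - l)⁻¹ • S (f w)‖ ≤ R⁻¹ * (‖S‖ * (‖x‖ * (R - ‖S‖)⁻¹)) := by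
      intro w hw
      have hwR : ‖w - l‖ = R := by rw [← dist_eq_norm]; exact hw
      -- Decay of `f` is not assumed; it follows from `(w - l) f w = S (f w) - x` once `R > ‖S‖`.
      have hb : ‖f w‖ ≤ ‖x‖ * (R - ‖S‖)⁻¹ := by
        rw [← div_eq_mul_inv, le_div_iff₀ hSR]
        have h6 : R * ‖f w‖ ≤ ‖S‖ * ‖f w‖ + ‖x‖ := by
          rw [← hwR, ← norm_smul, hSf w (hne R hR0 w hw)]
          exact (norm_sub_le _ _).trans (by gcongr; exact S.le_opNorm _)
        linarith
      rw [norm_smul, norm_inv, hwR]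
      gcongr
      exact (S.le_opNorm _).trans (by gcongr)
    refine (circleIntegral.norm_integral_le_of_norm_le_const hR0.le h5).trans (le_of_eq ?_)
    field_simp
  have h7 : (∮ w in C(l, r), f w) + (2 * π * I : ℂ) • x = 0 := by
    rw [← norm_le_zero_iff]
    have hlim : Filter.Tendsto (fun R : ℝ => (2 * π * (‖S‖ * ‖x‖)) * (R - ‖S‖)⁻¹) Filter.atTop
        (𝓝 0) := by
      rw [← mul_zero (2 * π * (‖S‖ * ‖x‖))]
      exact (tendsto_inv_atTop_zero.comp
        (Filter.tendsto_atTop_add_const_right _ (-‖S‖) Filter.tendsto_id)).const_mul _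
    exact ge_of_tendsto hlim ((Filter.eventually_gt_atTop _).mono h3)
  rw [rieszProjection, neg_apply, smul_apply, h1, eq_neg_of_add_eq_zero_left h7, smul_neg,
    inv_smul_smul₀ Complex.two_pi_I_ne_zero, neg_neg]

/-- The Riesz projection is compact if `T - w` has a finite rank perturbation which is invertible
on the whole disc. -/
lemma isCompactOperator_rieszProjection {n : ℕ} {J : (Fin n → ℂ) →L[ℂ] X}
    {Q : X →L[ℂ] (Fin n → ℂ)} (hr : 0 ≤ r) (hu : ∀ w ∈ sphere l r, IsUnit (shift T w))
    (hA : ∀ w ∈ closedBall l r, IsUnit (shift T w + J ∘L Q)) :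
    IsCompactOperator (rieszProjection T l r) := by
  have hdA : Differentiable ℂ (fun z => shift T z + J ∘L Q) :=
    (differentiable_shift T).add_const _
  have hcR := continuousOn_inverse_shift hu
  have hcA := (differentiableOn_inverse hdA hA).continuousOn
  have h0 : (∮ w in C(l, r), Ring.inverse (shift T w + J ∘L Q)) = 0 :=
    Complex.circleIntegral_eq_zero_of_differentiable_on_off_countable hr Set.countable_empty hcA
      fun w hw => DifferentiableAt.comp (g := Ring.inverse) w
        (differentiableAt_inverse (hA w (ball_subset_closedBall hw.1))) hdA.differentiableAt
  have h1 : (∮ w in C(l, r), Ring.inverse (shift T w)) =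
      ∮ w in C(l, r), (Ring.inverse (shift T w) - Ring.inverse (shift T w + J ∘L Q)) := by
    rw [circleIntegral.integral_sub (hcR.circleIntegrable hr)
      ((hcA.mono sphere_subset_closedBall).circleIntegrable hr), h0, sub_zero]
  have hQ : IsCompactOperator Q := isCompactOperator_of_locallyCompactSpace_dom Q
  have hmem : (∮ w in C(l, r), Ring.inverse (shift T w)) ∈ compactOperator (RingHom.id ℂ) X X := by
    rw [h1]
    refine circleIntegral_mem isClosed_setOfPred_isCompactOperator hr
      ((hcR.sub (hcA.mono sphere_subset_closedBall)).circleIntegrable hr) fun w hw => ?_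
    -- The inverse of the perturbed operator integrates to zero over the circle, and its difference
    -- from the resolvent factors through `Fin n → ℂ`. The integral is thus a limit of finite rank
    -- operators.
    have h2 : Ring.inverse (shift T w) - Ring.inverse (shift T w + J ∘L Q) =
        (Ring.inverse (shift T w + J ∘L Q) ∘L J) ∘L (Q ∘L Ring.inverse (shift T w)) := by
      ext x
      have h3 := inverse_apply_apply (hA w (sphere_subset_closedBall hw))
        (Ring.inverse (shift T w) x)
      rw [add_apply, apply_inverse_apply (hu w hw), map_add] at h3
      simp only [sub_apply, ContinuousLinearMap.comp_apply] at h3 ⊢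
      conv_lhs => rw [← h3]
      abel
    rw [h2]
    exact (hQ.comp_clm (Ring.inverse (shift T w))).clm_comp (Ring.inverse (shift T w + J ∘L Q) ∘L J)
  exact ((compactOperator (RingHom.id ℂ) X X).smul_mem _ hmem).neg

end RieszProjection

/-! ### Closed range and continuity of the reduced minimum modulus -/

section ReducedMinModulus

lemma enorm_mk_eq_infEDist (N : Submodule ℂ X) (x : X) :
    ‖(N.mkQ x : X ⧸ N)‖ₑ = Metric.infEDist x (N : Set X) := by
  rw [← ofReal_norm, ← ENNReal.ofReal_toReal
    (Metric.infEDist_ne_top (s := (N : Set X)) (x := x) ⟨0, N.zero_mem⟩)]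
  congr 1
  exact QuotientAddGroup.norm_mk (S := N.toAddSubgroup) x

/-- The reduced minimum modulus at `z` is nonzero exactly when `T - z` has closed range. -/
theorem reducedMinModulus_ne_zero_iff [CompleteSpace X] {T : X →L[ℂ] X} {z : ℂ} :
    reducedMinModulus T z ≠ 0 ↔ IsClosed ((shift T z).range : Set X) := by
  set S := shift T z with hS
  have hN : IsClosed (S.ker : Set X) := S.isClosed_ker
  have hN' : IsClosed (S.ker.toAddSubgroup : Set X) := hN
  -- The distance to the kernel is the quotient norm, so a positive lower bound for the modulus says
  -- that the induced injection `L` is bounded below.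
  let L : X ⧸ S.ker →L[ℂ] X := S.ker.liftQL S le_rfl
  have hL (x : X) : L (S.ker.mkQ x) = S x := rfl
  have hinj : Function.Injective L := LinearMap.ker_eq_bot.1 (Submodule.ker_liftQ_eq_bot' _ _ rfl)
  have hrange : Set.range L = (S.range : Set X) := by
    ext y
    constructor
    · rintro ⟨q, rfl⟩
      obtain ⟨x, rfl⟩ := S.ker.mkQ_surjective q
      exact ⟨x, rfl⟩
    · rintro ⟨x, rfl⟩
      exact ⟨S.ker.mkQ x, rfl⟩
  rw [← hrange, L.isClosed_range_iff_antilipschitz_of_injective hinj]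
  have hpos (x : X) (hx : x ∉ S.ker) : Metric.infEDist x (S.ker : Set X) ≠ 0 := by
    rw [← enorm_mk_eq_infEDist, enorm_ne_zero]
    exact fun h => hx ((Submodule.Quotient.mk_eq_zero _).1 h)
  have hfin (x : X) : Metric.infEDist x (S.ker : Set X) ≠ ∞ :=
    Metric.infEDist_ne_top ⟨0, S.ker.zero_mem⟩
  constructor
  · intro h
    obtain ⟨a, ha0, ha⟩ := ENNReal.lt_iff_exists_nnreal_btwn.1 (pos_iff_ne_zero.2 h)
    have ha0' : a ≠ 0 := by
      rintro rfl
      exact lt_irrefl _ ha0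
    have hle (x : X) : a * ‖S.ker.mkQ x‖ₑ ≤ ‖S x‖ₑ := by
      by_cases hx : x ∈ S.ker
      · have : S.ker.mkQ x = 0 := (Submodule.Quotient.mk_eq_zero _).2 hx
        simp [this]
      · rw [enorm_mk_eq_infEDist]
        exact (ENNReal.le_div_iff_mul_le (.inl (hpos x hx)) (.inl (hfin x))).1
          (ha.le.trans (iInf₂_le x hx))
    refine ⟨a⁻¹, fun p q => ?_⟩
    obtain ⟨x, hx⟩ := S.ker.mkQ_surjective (p - q)
    rw [edist_eq_enorm_sub, edist_eq_enorm_sub, ← map_sub, ← hx, hL, ENNReal.coe_inv ha0',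
      ← ENNReal.div_eq_inv_mul]
    rw [ENNReal.le_div_iff_mul_le (.inl (by simpa using ha0')) (.inl ENNReal.coe_ne_top), mul_comm]
    exact hle x
  · rintro ⟨K, hK⟩ h
    have hle : ((K + 1 : NNReal) : ℝ≥0∞)⁻¹ ≤ reducedMinModulus T z := by
      refine le_iInf₂ fun x hx => ?_
      rw [ENNReal.le_div_iff_mul_le (.inl (hpos x hx)) (.inl (hfin x)), ← enorm_mk_eq_infEDist,
        ← ENNReal.div_eq_inv_mul]
      refine ENNReal.div_le_of_le_mul' ?_
      have h1 := hK (S.ker.mkQ x) 0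
      rw [map_zero, edist_zero_right, edist_zero_right, hL] at h1
      refine h1.trans ?_
      gcongr
      simp
    rw [h, nonpos_iff_eq_zero, ENNReal.inv_eq_zero] at hle
    exact ENNReal.coe_ne_top hle

/-- The eigenvector `e` serves as test vector: `(T - z) e = (l - z) e`, and the distance of `e` to
the trivial kernel of `T - z` is its norm. -/
lemma reducedMinModulus_le_of_isUnit {T : X →L[ℂ] X} {z l : ℂ} (hz : IsUnit (shift T z))
    {e : X} (he0 : e ≠ 0) (he : shift T l e = 0) : reducedMinModulus T z ≤ ‖l - z‖ₑ := by
  have hker : (shift T z).ker = ⊥ := by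
    rw [LinearMap.ker_eq_bot]
    exact fun x y h => by
      rw [← inverse_apply_apply hz x, ← inverse_apply_apply hz y]
      exact congrArg _ h
  have hes : shift T z e = (l - z) • e := by
    rw [shift_apply, sub_eq_zero] at he
    rw [shift_apply, he, sub_smul]
  refine (iInf₂_le e (by rwa [hker, Submodule.mem_bot])).trans ?_
  rw [hker, hes, enorm_smul]
  refine ENNReal.div_le_of_le_mul ?_
  simp

/-- At an isolated point of the spectrum which is an eigenvalue, the reduced minimum modulus is
continuous exactly when it vanishes. -/
theorem continuousAt_reducedMinModulus_iff {T : X →L[ℂ] X} {l : ℂ}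
    (hu : ∀ᶠ z in 𝓝[≠] l, IsUnit (shift T z)) {e : X} (he0 : e ≠ 0) (he : shift T l e = 0) :
    ContinuousAt (reducedMinModulus T) l ↔ reducedMinModulus T l = 0 := by
  have hlim : Filter.Tendsto (reducedMinModulus T) (𝓝[≠] l) (𝓝 0) := by
    have h1 : Filter.Tendsto (fun z : ℂ => ‖l - z‖ₑ) (𝓝[≠] l) (𝓝 0) := by
      have h2 : Continuous fun z : ℂ => ‖l - z‖ₑ := by fun_prop
      have h3 := h2.tendsto l
      rw [sub_self, enorm_zero] at h3
      exact h3.mono_left nhdsWithin_le_nhds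
    exact tendsto_of_tendsto_of_tendsto_of_le_of_le' tendsto_const_nhds h1
      (.of_forall fun _ => zero_le)
      (hu.mono fun z hz => reducedMinModulus_le_of_isUnit hz he0 he)
  refine ⟨fun h => tendsto_nhds_unique (h.mono_left nhdsWithin_le_nhds) hlim, fun h => ?_⟩
  rw [continuousAt_iff_punctured_nhds, h]
  exact hlim

end ReducedMinModulus

/-! ### Isolated points of the spectrum and the equivalences -/

variable {T : X →L[ℂ] X} {l : ℂ}

lemma exists_isUnit_shift_of_mem_iso (hl : l ∈ iso (spectrum ℂ T)) :
    ∃ R > 0, ∀ w ∈ Metric.ball l R, w ≠ l → IsUnit (shift T w) := by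
  have h := (mem_iso_spectrum_iff.1 hl).2
  rw [eventually_nhdsWithin_iff, Metric.eventually_nhds_iff_ball] at h
  exact h

lemma isUnit_shift_of_mem_sphere {R r : ℝ} (hr : 0 < r) (hrR : r < R)
    (hu : ∀ w ∈ Metric.ball l R, w ≠ l → IsUnit (shift T w)) :
    ∀ w ∈ Metric.sphere l r, IsUnit (shift T w) := fun w hw =>
  hu w (Metric.mem_ball.2 (Metric.mem_sphere.1 hw ▸ hrR)) (by
    rintro rfl
    exact hr.ne (by simpa using hw))

variable [CompleteSpace X]

/-- At a point of `π₀₀(T)` with `T - l` of closed range, `T - l` is Fredholm of index zero. -/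
lemma isWeyl_of_mem_pi00 (hl : l ∈ pi00 T) (hcl : IsClosed ((shift T l).range : Set X)) :
    IsWeyl (shift T l) := by
  have : FiniteDimensional ℂ (shift T l).ker := Module.rank_lt_aleph0_iff.1 hl.2.2
  exact isWeyl_of_isClosed_range hcl
    ((mem_iso_spectrum_iff.1 hl.1).2.frequently.filter_mono nhdsWithin_le_nhds)

/-- If `T - l` is Fredholm of index zero at an isolated point `l` of the spectrum, then the glocal
spectral subspace of `{l}` is finite dimensional. -/
theorem finiteDimensional_glocalSubspace (hl : l ∈ iso (spectrum ℂ T))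
    (hW : IsWeyl (shift T l)) : FiniteDimensional ℂ (glocalSubspace T {l}) := by
  obtain ⟨n, J, Q, hA⟩ := hW.exists_isUnit_add
  have hev : ∀ᶠ z in 𝓝 l, IsUnit (shift T z + J ∘L Q) :=
    ((continuous_shift T).add continuous_const).continuousAt.eventually_mem
      (Units.isOpen.mem_nhds hA)
  obtain ⟨s, hs, hball⟩ := Metric.eventually_nhds_iff_ball.1 hev
  obtain ⟨R, hR, hu⟩ := exists_isUnit_shift_of_mem_iso hl
  obtain ⟨r, hr, hrlt⟩ := exists_between (lt_min hs hR)
  have hus := isUnit_shift_of_mem_sphere hr (hrlt.trans_le (min_le_right _ _)) hu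
  have hcomp := isCompactOperator_rieszProjection hr.le hus fun w hw =>
    hball w (Metric.closedBall_subset_ball (hrlt.trans_le (min_le_left _ _)) hw)
  set P := rieszProjection T l r
  -- On the fixed space of `P` the identity is a restriction of the compact `P`, so Riesz's theorem
  -- applies; idempotence of `P` is not needed.
  let V : Submodule ℂ X := P.eqLocus (ContinuousLinearMap.id ℂ X)
  have hV : IsClosed (V : Set X) := isClosed_eq P.continuous continuous_id
  have : CompleteSpace V := hV.completeSpace_coe
  have hPV : ∀ v ∈ V, P v = v := fun v hv => hv
  have hid : IsCompactOperator (id : V → V) := by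
    have h := IsCompactOperator.restrict' (f := P.toLinearMap) hcomp (V := V)
      fun v hv => (hPV v hv).symm ▸ hv
    convert h using 1
    ext v
    exact (hPV v v.2).symm
  have : FiniteDimensional ℂ V := .of_isCompactOperator_id hid
  exact Submodule.finiteDimensional_of_le (S₂ := V) fun x hx =>
    rieszProjection_apply_of_mem hr hus hx

/-- If the glocal spectral subspace of an isolated point `l` of the spectrum is finite dimensional,
then `T - l` has closed range. -/
theorem isClosed_range_of_finiteDimensional_glocalSubspace (hl : l ∈ iso (spectrum ℂ T))
    [FiniteDimensional ℂ (glocalSubspace T {l})] : IsClosed ((shift T l).range : Set X) := by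
  obtain ⟨R, hR, hu⟩ := exists_isUnit_shift_of_mem_iso hl
  obtain ⟨r, hr, hrR⟩ := exists_between hR
  have hSB := shift_mul_resolventCauchy_center hr (isUnit_shift_of_mem_sphere hr hrR hu)
  set P := rieszProjection T l r
  have hP : P.range ≤ glocalSubspace T {l} := by
    rintro _ ⟨x, rfl⟩
    exact rieszProjection_mem_glocalSubspace hr hrR hu x
  have : FiniteDimensional ℂ P.range := Submodule.finiteDimensional_of_le hP
  have hle : P.ker ≤ (shift T l).range := fun x hx => ⟨resolventCauchy T l r l x, by
    have h0 : P x = 0 := hx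
    have h1 := congrArg (fun A : X →L[ℂ] X => A x) hSB
    simpa [h0] using h1⟩
  have : IsClosed (P.ker : Set X) := P.isClosed_ker
  have : IsClosed (P.ker.toAddSubgroup : Set X) := this
  have : FiniteDimensional ℂ (X ⧸ P.ker) :=
    P.toLinearMap.quotKerEquivRange.symm.finiteDimensional
  -- A subspace containing the closed, finite codimensional `P.ker` is the preimage of a subspace of
  -- a finite dimensional quotient.
  have h2 : IsClosed (((shift T l).range.map P.ker.mkQ).comap P.ker.mkQ : Set X) :=
    (Submodule.closed_of_finiteDimensional ((shift T l).range.map P.ker.mkQ)).preimage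
      P.ker.mkQL.continuous
  rwa [Submodule.comap_map_mkQ, sup_eq_right.2 hle] at h2

/-- Under the single valued extension property, `σ(T) \ ω(T) ⊆ π₀₀(T)`. -/
theorem HasSVEP.spectrum_diff_weylSpectrum_subset (hT : HasSVEP T) :
    spectrum ℂ T \ weylSpectrum T ⊆ pi00 T := by
  rintro l ⟨hl, hlw⟩
  have hW : IsWeyl (shift T l) := not_not.1 hlw
  have hfd := hW.isFredholm.finite_ker
  have hq : FiniteDimensional ℂ (X ⧸ (shift T l).range) := hW.isFredholm.finite_coker
  refine ⟨hT.mem_iso_of_isWeyl hl hW, ?_, Module.rank_lt_aleph0_iff.2 hfd⟩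
  rw [pos_iff_ne_zero]
  -- A trivial kernel and index zero would make `T - l` bijective, contradicting `l ∈ σ(T)`.
  intro h0
  have hf0 : Module.finrank ℂ (shift T l).ker = 0 := Module.finrank_eq_zero_of_rank_eq_zero h0
  have hq0 : Module.finrank ℂ (X ⧸ (shift T l).range) = 0 := by
    have := hW.index_eq_zero
    omega
  refine isUnit_shift_iff.1 (ContinuousLinearMap.isUnit_iff_bijective.2 ⟨?_, ?_⟩) hl
  · exact LinearMap.ker_eq_bot.1 (Submodule.finrank_eq_zero.1 hf0)
  · exact LinearMap.range_eq_top.1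
      (Submodule.Quotient.subsingleton_iff.1 (Module.finrank_zero_iff.1 hq0))

end SpectralTheory

theorem theorem2p2 {X : Type*} [NormedAddCommGroup X] [NormedSpace ℂ X] [CompleteSpace X]
    (T : X →L[ℂ] X) (hT : SpectralTheory.HasSVEP T) :
    List.TFAE
      [SpectralTheory.WeylTheoremHolds T,
       ∀ l ∈ SpectralTheory.pi00 T, IsClosed ((SpectralTheory.shift T l).range : Set X),
       ∀ l ∈ SpectralTheory.pi00 T,
         FiniteDimensional ℂ (SpectralTheory.glocalSubspace T {l}),
       ∀ l ∈ SpectralTheory.pi00 T,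
         ¬ ContinuousAt (SpectralTheory.reducedMinModulus T) l] := by
  open SpectralTheory in
  tfae_have 1 → 2 := fun h l hl => by
    have hl' : l ∈ spectrum ℂ T \ weylSpectrum T := by rwa [h]
    exact (not_not.1 hl'.2 : IsWeyl (shift T l)).isFredholm.isClosed_range
  -- SVEP enters the equivalences only here, through the automatic inclusion.
  tfae_have 2 → 1 := fun h =>
    hT.spectrum_diff_weylSpectrum_subset.antisymm fun l hl =>
      ⟨(mem_iso_spectrum_iff.1 hl.1).1, not_not.2 (isWeyl_of_mem_pi00 hl (h l hl))⟩
  tfae_have 2 → 3 := fun h l hl =>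
    finiteDimensional_glocalSubspace hl.1 (isWeyl_of_mem_pi00 hl (h l hl))
  tfae_have 3 → 2 := fun h l hl => by
    have := h l hl
    exact isClosed_range_of_finiteDimensional_glocalSubspace hl.1
  tfae_have 2 ↔ 4 := by
    refine forall₂_congr fun l hl => ?_
    obtain ⟨e, he, he0⟩ := exists_mem_ne_zero_of_rank_pos hl.2.1
    rw [continuousAt_reducedMinModulus_iff (mem_iso_spectrum_iff.1 hl.1).2 he0 he]
    exact reducedMinModulus_ne_zero_iff.symm
  tfae_finish
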